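/- Let $\mathbb X$ be a separable real Banach space with dual $\mathbb X^*$, let $(\Omega,\mathcal F,\mathbf P)$ be a complete probability space and let $\mathcal H\subseteq\mathcal F$ be a sub-$\sigma$-algebra. *Conventions.* An $\mathcal H$-measurable random set is a map $Y:\Omega\to 2^{\mathbb X}$ whose graph $\{(\omega,x):x\in Y(\omega)\}$ belongs to $\mathcal H\otimes\mathcal B(\mathbb X)$. $L^0(\mathbb X,\mathcal H)$ is the set of $\mathcal H$-measurable maps $\Omega\to\mathbb X$, and $L^0(\mathbb X^*,\mathcal H)$ is the set of maps $\zeta:\Omega\to\mathbb X^*$ such that $\langle\zeta,x\rangle$ is $\mathcal H$-measurable for all $x\in\mathbb X$; similarly for $\mathcal F$. The support function is $h_A(u)=\sup_{x\in A}\langle u,x\rangle\in[-\infty,\infty]$, with $h_\emptyset=-\infty$. The conditional core $\mathbf m(X|\mathcal H)$ is the largest $\mathcal H$-measurable random set $X'$ with $X'\subseteq X$ a.s. For a $[-\infty,\infty]$-valued $\xi$, $\operatorname{essinf}_{\mathcal H}\xi$ is the largest $\mathcal H$-measurable $[-\infty,\infty]$-valued random variable that is a.s. at most $\xi$. Both are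 unique up to a.s. equality. For $\zeta\in L^0(\mathbb X^*,\mathcal F)$, the random field $x\mapsto \operatorname{essinf}_{\mathcal H}(h_X(\zeta)-\langle\zeta,x\rangle)$ is understood through an $\mathcal H\otimes\mathcal B(\mathbb X)$-measurable version, that is, an $\mathcal H\otimes\mathcal B(\mathbb X)$-measurable $\eta_\zeta:\Omega\times\mathbb X\to[-\infty,\infty]$ such that, for every $\gamma\in L^0(\mathbb X,\mathcal H)$, $\eta_\zeta(\cdot,\gamma(\cdot))$ is the $\mathcal H$-conditional essential infimum of $h_X(\zeta)-\langle\zeta,\gamma\rangle$. An uncountable intersection of set-valued maps, each given up to a null event, is understood as its $\mathcal H$-measurable version: the largest $\mathcal H$-measurable random set that is a.s. contained in each member of the family. **Theorem.** Let $X$ be an $\mathcal F$-measurable random set whose values are a.s. non-empty, closed and convex. Then $\mathbf m(X|\mathcal H)$ exists; $\operatorname{essinf}_{\mathcal H}h_X(\zeta)$ and a version $\eta_\zeta$ as above exist for every $\zeta\in L^0(\mathbb X^*,\mathcal F)$; and the following holds. 1. For every $\zeta\in L^0(\mathbb X^*,\mathcal H)$, $$h_{\mathbf m(X|\mathcal H)}(\zeta)\le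 \operatorname{essinf}_{\mathcal H}h_X(\zeta)\quad\text{a.s.}$$ 2. For all choices of the versions, $$\mathbf m(X|\mathcal H)=\bigcap_{\zeta\in L^0(\mathbb X^*,\mathcal F)}\bigl\{x\in\mathbb X:\operatorname{essinf}_{\mathcal H}\bigl(h_X(\zeta)-\langle\zeta,x\rangle\bigr)\ge 0\bigr\}$$ in the sense of the measurable version of the intersection. 3. There are sequences $(\zeta_n)_{n\ge1}$ in $L^0(\mathbb X^*,\mathcal F)$ with $$X=\bigcap_{n\ge1}\{x\in\mathbb X:\langle\zeta_n,x\rangle\le h_X(\zeta_n)\}\quad\text{a.s.},$$ and for every such sequence and all choices of the versions, $$\mathbf m(X|\mathcal H)=\bigcap_{n\ge1}\bigl\{x\in\mathbb X:\operatorname{essinf}_{\mathcal H}\bigl(h_X(\zeta_n)-\langle\zeta_n,x\rangle\bigr)\ge 0\bigr\}\quad\text{a.s.}$$ 4. Suppose in addition that $X$ is a.s. weakly compact. Let $\mathbb X^*_0\subseteq\mathbb X^*$ be any countable set whose norm closure contains a linear subspace of $\mathbb X^*$ separating the points of $\mathbb X$ (for instance, the set of all rational linear combinations of a countable total set; such sets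 $\mathbb X^*_0$ exist). Then $$\mathbf m(X|\mathcal H)=\bigcap_{u\in\mathbb X^*_0}\bigl\{x\in\mathbb X:\langle u,x\rangle\le\operatorname{essinf}_{\mathcal H}h_X(u)\bigr\}\quad\text{a.s.},$$ and $\mathbf m(X|\mathcal H)$ is also the measurable version of the intersection of the same sets over all $u\in\mathbb X^*$. -/

import Mathlib

open MeasureTheory

/-- The support function `h_A(u) = sup {⟨u, x⟩ : x ∈ A}` with values in `[-∞, ∞]`;
`h_∅ = -∞`. -/
noncomputable def supportFn {E : Type*} [NormedAddCommGroup E] [NormedSpace ℝ E]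
    (A : Set E) (u : E →L[ℝ] ℝ) : EReal :=
  ⨆ x ∈ A, ((u x : ℝ) : EReal)

/-- `X` is an `m`-measurable random set: its graph lies in `m ⊗ 𝓑(E)`. -/
def IsRandomSet {Ω E : Type*} [MeasurableSpace E] (m : MeasurableSpace Ω)
    (X : Ω → Set E) : Prop :=
  MeasurableSet[m.prod inferInstance] {p : Ω × E | p.2 ∈ X p.1}

/-- `ζ` is an `m`-measurable random element of the dual space with its weak-star structure:
`⟨ζ, x⟩` is an `m`-measurable random variable for each `x`. -/
def IsRandomDual {Ω E : Type*} [NormedAddCommGroup E] [NormedSpace ℝ E]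
    (m : MeasurableSpace Ω) (ζ : Ω → E →L[ℝ] ℝ) : Prop :=
  ∀ x : E, Measurable[m] (fun ω => ζ ω x)

/-- `M` is (a version of) the conditional core of `X` given `H`: the largest `H`-measurable
random set that is almost surely contained in `X`. -/
def IsCondCore {Ω E : Type*} [MeasurableSpace E] (H : MeasurableSpace Ω)
    {mΩ : MeasurableSpace Ω} (μ : Measure Ω) (X M : Ω → Set E) : Prop :=
  IsRandomSet H M ∧ (∀ᵐ ω ∂μ, M ω ⊆ X ω) ∧
    ∀ Y : Ω → Set E, IsRandomSet H Y → (∀ᵐ ω ∂μ, Y ω ⊆ X ω) → ∀ᵐ ω ∂μ, Y ω ⊆ M ω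

/-- `M` is (the `H`-measurable version of) the intersection of a possibly uncountable family of
set-valued maps, each of them given up to a null event: the largest `H`-measurable random set
that is almost surely contained in each member of the family. -/
def IsMeasurableInter {Ω E ι : Type*} [MeasurableSpace E] (H : MeasurableSpace Ω)
    {mΩ : MeasurableSpace Ω} (μ : Measure Ω) (S : ι → Ω → Set E) (M : Ω → Set E) : Prop :=
  IsRandomSet H M ∧ (∀ i, ∀ᵐ ω ∂μ, M ω ⊆ S i ω) ∧
    ∀ Y : Ω → Set E, IsRandomSet H Y → (∀ i, ∀ᵐ ω ∂μ, Y ω ⊆ S i ω) → ∀ᵐ ω ∂μ, Y ω ⊆ M ω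

/-- `g` is (a version of) the `H`-conditional essential infimum of `ξ`: the largest
`H`-measurable `[-∞, ∞]`-valued random variable that is almost surely at most `ξ`. -/
def IsCondEssInf {Ω : Type*} (H : MeasurableSpace Ω) {mΩ : MeasurableSpace Ω} (μ : Measure Ω)
    (ξ g : Ω → EReal) : Prop :=
  Measurable[H] g ∧ (∀ᵐ ω ∂μ, g ω ≤ ξ ω) ∧
    ∀ g' : Ω → EReal, Measurable[H] g' → (∀ᵐ ω ∂μ, g' ω ≤ ξ ω) → ∀ᵐ ω ∂μ, g' ω ≤ g ω

/-- `η` is a version of the random field `x ↦ essinf_H f(x)` on `E`: it is jointly measurable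
with respect to `H ⊗ 𝓑(E)`, and for each `H`-measurable random point `γ` (in particular for
each deterministic point) the value `η(γ)` is the conditional essential infimum of `f(γ)`. -/
def IsCondEssInfField {Ω E : Type*} [MeasurableSpace E] (H : MeasurableSpace Ω)
    {mΩ : MeasurableSpace Ω} (μ : Measure Ω) (f η : Ω → E → EReal) : Prop :=
  Measurable[H.prod inferInstance] (fun p : Ω × E => η p.1 p.2) ∧
    ∀ γ : Ω → E, Measurable[H] γ →
      IsCondEssInf H μ (fun ω => f ω (γ ω)) (fun ω => η ω (γ ω))

/-- The random field `x ↦ h_X(ζ) - ⟨ζ, x⟩`. -/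
noncomputable def supportGap {Ω E : Type*} [NormedAddCommGroup E] [NormedSpace ℝ E]
    (X : Ω → Set E) (ζ : Ω → E →L[ℝ] ℝ) (ω : Ω) (x : E) : EReal :=
  supportFn (X ω) (ζ ω) - ((ζ ω x : ℝ) : EReal)

/-- The sequence `ζ` of random elements of the dual represents `X` as the intersection of the
random half-spaces `{x : ⟨ζ n, x⟩ ≤ h_X(ζ n)}`, almost surely. -/
def IsHalfspaceRep {Ω E : Type*} [NormedAddCommGroup E] [NormedSpace ℝ E]
    {mΩ : MeasurableSpace Ω} (μ : Measure Ω) (X : Ω → Set E) (ζ : ℕ → Ω → E →L[ℝ] ℝ) : Prop :=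
  (∀ n, IsRandomDual mΩ (ζ n)) ∧
    ∀ᵐ ω ∂μ, X ω = ⋂ n, {x : E | ((ζ n ω x : ℝ) : EReal) ≤ supportFn (X ω) (ζ n ω)}

/-- A countable set of functionals whose norm closure contains a linear subspace that separates
the points of `E`; for instance, all rational linear combinations of a countable total set. -/
def IsCountableTotal {E : Type*} [NormedAddCommGroup E] [NormedSpace ℝ E]
    (D : Set (E →L[ℝ] ℝ)) : Prop :=
  D.Countable ∧ ∃ V : Submodule ℝ (E →L[ℝ] ℝ),
    (∀ x : E, (∀ u ∈ V, u x = 0) → x = 0) ∧ (V : Set (E →L[ℝ] ℝ)) ⊆ closure D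

/-- Compactness in the weak topology. -/
def IsWeaklyCompact {E : Type*} [NormedAddCommGroup E] [NormedSpace ℝ E] (A : Set E) : Prop :=
  IsCompact (toWeakSpace ℝ E '' A)

/-! Let `γ` be an `H`-measurable point of `X`. Then `h_X(ζ) - ⟨ζ, γ⟩ ≥ 0`, and since `0` is
`H`-measurable, the conditional essential infimum is also `≥ 0`. Conversely, if this infimum is `≥
0` for every member of a sequence representing `X`, then `γ` satisfies all the half-space
inequalities and lies in `X`. Hence the countable intersection in part 3 is a conditional core
(`IsHalfspaceRep.isCondCore`), and uniqueness of the core identifies every other version with it.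
The uncountable intersection contains such a sequence among its indices.

Passing from points to sets needs an almost sure measurable selection theorem
(`exists_measurable_selection`), which also yields the Castaing and half-space representations. The
field `η` is built from conditional distributions (`exists_measurable_essInf_given`). For weakly
compact `X`, finite-dimensional separation and boundedness allow a countable set of deterministic
functionals (`IsWeaklyCompact.mem_of_isCountableTotal`). -/

/-! ### Measurable selection -/

open Set Filter Topology in
/-- The image of the Baire space under a continuous map is approximated in measure from inside by
images of compact sets. -/
theorem exists_isCompact_measure_range_le {Z : Type*} [TopologicalSpace Z] [MeasurableSpace Z]
    (ν : Measure Z) [ν.OuterRegular] [IsFiniteMeasure ν] {f : (ℕ → ℕ) → Z} (hf : Continuous f)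
    {ε : ENNReal} (hε : ε ≠ 0) :
    ∃ K : Set (ℕ → ℕ), IsCompact K ∧ ν (range f) ≤ ν (f '' K) + ε := by
  obtain ⟨δ, hδ0, hδ⟩ := ENNReal.exists_pos_sum_of_countable' hε ℕ
  have step : ∀ (S : Set (ℕ → ℕ)) (k : ℕ), ∃ m : ℕ,
      ν (f '' S) ≤ ν (f '' (S ∩ {σ | σ k ≤ m})) + δ k := by
    intro S k
    have hmono : Monotone fun m : ℕ => f '' (S ∩ {σ | σ k ≤ m}) := fun a b hab =>
      image_mono (inter_subset_inter_right _ fun σ (hσ : σ k ≤ a) => hσ.trans hab)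
    have hU : (⋃ m : ℕ, f '' (S ∩ {σ | σ k ≤ m})) = f '' S := by
      rw [← image_iUnion, ← inter_iUnion]
      congr 1
      refine inter_eq_left.2 fun σ _ => mem_iUnion.2 ⟨σ k, le_refl (σ k)⟩
    have h := hmono.measure_iUnion (μ := ν)
    rw [hU] at h
    by_contra! hcon
    have h1 : ν (f '' S) + δ k ≤ ν (f '' S) := by
      calc ν (f '' S) + δ k = (⨆ m : ℕ, ν (f '' (S ∩ {σ | σ k ≤ m}))) + δ k := by rw [← h]
        _ = ⨆ m : ℕ, (ν (f '' (S ∩ {σ | σ k ≤ m})) + δ k) := ENNReal.iSup_add ..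
        _ ≤ ν (f '' S) := iSup_le fun m => (hcon m).le
    exact absurd h1 (not_le.2 (ENNReal.lt_add_right (measure_ne_top _ _) (hδ0 k).ne'))
  choose m hm using step
  -- Coordinates are bounded one at a time; bounding coordinate `k` costs at most `δ k` of measure.
  let S : ℕ → Set (ℕ → ℕ) := fun k => Nat.rec univ (fun k S => S ∩ {σ | σ k ≤ m S k}) k
  have hS0 : S 0 = univ := rfl
  have hS1 : ∀ k, S (k + 1) = S k ∩ {σ | σ k ≤ m (S k) k} := fun k => rfl
  let n : ℕ → ℕ := fun k => m (S k) k
  have hSn : ∀ k, S k = {σ | ∀ i < k, σ i ≤ n i} := by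
    intro k
    induction k with
    | zero => simp [hS0]
    | succ k ih =>
      rw [hS1, ih]
      ext σ
      simp only [mem_inter_iff, mem_ofPred_eq, Nat.lt_succ_iff_lt_or_eq]
      constructor
      · rintro ⟨h1, h2⟩ i (hi | rfl)
        · exact h1 i hi
        · simpa [n, ih] using h2
      · intro h
        refine ⟨fun i hi => h i (Or.inl hi), ?_⟩
        simpa [n, ih] using h k (Or.inr rfl)
  have hνS : ∀ k, ν (range f) ≤ ν (f '' S k) + ∑ i ∈ Finset.range k, δ i := by
    intro k
    induction k with
    | zero => simp [hS0]
    | succ k ih =>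
      refine ih.trans ?_
      rw [Finset.sum_range_succ, add_comm (Finset.sum _ _), ← add_assoc, hS1]
      gcongr
      exact hm (S k) k
  have hνS' : ∀ k, ν (range f) ≤ ν (f '' S k) + ε := fun k =>
    (hνS k).trans (add_le_add_right ((ENNReal.sum_le_tsum _).trans hδ.le) _)
  let K : Set (ℕ → ℕ) := Set.pi univ fun i => Iic (n i)
  have hK : IsCompact K := isCompact_univ_pi fun i => (finite_Iic (n i)).isCompact
  refine ⟨K, hK, ?_⟩
  -- The images `f '' S k` need not be measurable, so continuity from above is replaced by outer
  -- regularity. Truncating bad points of `S k` into `K` keeps their first `k` coordinates, so a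
  -- subsequence of them converges to a point of `K`.
  have key : ∀ U, IsOpen U → f '' K ⊆ U → ∃ k, f '' S k ⊆ U := by
    intro U hU hKU
    by_contra! hcon
    have : ∀ k, ∃ σ ∈ S k, f σ ∉ U := fun k => by
      obtain ⟨_, ⟨σ, hσ, rfl⟩, hσU⟩ := not_subset.1 (hcon k)
      exact ⟨σ, hσ, hσU⟩
    choose σ hσ hσU using this
    let τ : ℕ → ℕ → ℕ := fun k i => min (σ k i) (n i)
    obtain ⟨t, htK, φ, hφ, hlim⟩ := hK.tendsto_subseq (x := τ) fun k => by
      exact fun i _ => mem_Iic.2 (min_le_right _ _)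
    have hlim' : Tendsto (σ ∘ φ) atTop (𝓝 t) := by
      rw [tendsto_pi_nhds] at hlim ⊢
      intro i
      refine (hlim i).congr' ?_
      filter_upwards [eventually_gt_atTop i] with k hk
      have := hσ (φ k)
      rw [hSn] at this
      exact min_eq_left (this i (hk.trans_le (hφ.id_le k)))
    have := ((hf.tendsto t).comp hlim').eventually (hU.mem_nhds (hKU (mem_image_of_mem f htK)))
    obtain ⟨k, hk⟩ := this.exists
    exact hσU _ hk
  have : ν (range f) - ε ≤ ν (f '' K) := by
    rw [Set.measure_eq_iInf_isOpen (f '' K) ν]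
    refine le_iInf₂ fun U hKU => le_iInf fun hU => ?_
    obtain ⟨k, hk⟩ := key U hU hKU
    exact tsub_le_iff_right.2 ((hνS' k).trans (by gcongr))
  exact tsub_le_iff_right.1 this

open Set in
/-- A continuous map from a compact set of real numbers has a measurable right inverse: take the
least preimage. -/
theorem exists_measurable_rightInverse_of_isCompact_real {Z : Type*} [TopologicalSpace Z]
    [T2Space Z] [MeasurableSpace Z] [BorelSpace Z] {C : Set ℝ} (hC : IsCompact C) (hne : C.Nonempty)
    {G : C → Z} (hG : Continuous G) :
    ∃ s : Z → C, Measurable s ∧ ∀ z ∈ range G, G (s z) = z := by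
  classical
  have : CompactSpace C := isCompact_iff_compactSpace.1 hC
  obtain ⟨c₀, hc₀⟩ := hne
  have hmin : ∀ z : Z, ∃ t : C, z ∈ range G → G t = z ∧ ∀ t', G t' = z → t ≤ t' := by
    intro z
    by_cases hz : z ∈ range G
    · have hcl : IsCompact (G ⁻¹' {z}) := (isClosed_singleton.preimage hG).isCompact
      obtain ⟨t, ht⟩ := hcl.exists_isLeast hz
      exact ⟨t, fun _ => ⟨ht.1, fun t' h' => ht.2 h'⟩⟩
    · exact ⟨⟨c₀, hc₀⟩, fun h => absurd h hz⟩
  choose t ht using hmin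
  have hr : MeasurableSet (range G) := (isCompact_range hG).measurableSet
  refine ⟨fun z => if z ∈ range G then t z else ⟨c₀, hc₀⟩, ?_, fun z hz => ?_⟩
  · refine (MeasurableEmbedding.subtype_coe hC.measurableSet).measurable_comp_iff.1
      (measurable_of_Iic fun c => ?_)
    -- The least preimage is `≤ c` exactly on the image of the compact set `{t ≤ c}`.
    have : (Subtype.val ∘ fun z => if z ∈ range G then t z else (⟨c₀, hc₀⟩ : C)) ⁻¹' Iic c =
        G '' {t | (t : ℝ) ≤ c} ∪ ((range G)ᶜ ∩ {_z | c₀ ≤ c}) := by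
      ext z
      by_cases hz : z ∈ range G
      · simp only [mem_preimage, Function.comp_apply, hz, if_true, mem_Iic, mem_union, mem_inter_iff, mem_compl_iff,
          not_true, false_and, or_false, mem_image, mem_ofPred_eq]
        exact ⟨fun h => ⟨t z, h, (ht z hz).1⟩, fun ⟨t', h1, h2⟩ => le_trans (Subtype.coe_le_coe.2 ((ht z hz).2 t' h2)) h1⟩
      · have : z ∉ G '' {t | (t : ℝ) ≤ c} := fun h => hz (image_subset_range _ _ h)
        simp only [mem_preimage, Function.comp_apply, hz, if_false, mem_Iic, mem_union, mem_inter_iff, mem_compl_iff,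
          not_false_eq_true, true_and, this, false_or, mem_ofPred_eq]
    rw [this]
    exact ((isClosed_Iic.preimage continuous_subtype_val).isCompact.image hG).measurableSet.union (hr.compl.inter (.const _))
  · simp only [hz, if_true]
    exact (ht z hz).1

open Set in
/-- A continuous map on the Baire space has a measurable right inverse over the image of a compact
set. -/
theorem exists_measurable_rightInverse_of_isCompact {Z : Type*} [TopologicalSpace Z] [T2Space Z]
    [MeasurableSpace Z] [BorelSpace Z] {f : (ℕ → ℕ) → Z} (hf : Continuous f)
    {K : Set (ℕ → ℕ)} (hK : IsCompact K) :
    ∃ s : Z → ℕ → ℕ, Measurable s ∧ ∀ z ∈ f '' K, f (s z) = z := by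
  rcases K.eq_empty_or_nonempty with rfl | hne
  · exact ⟨fun _ => 0, measurable_const, by simp⟩
  have : CompactSpace K := isCompact_iff_compactSpace.1 hK
  have : Nonempty K := hne.to_subtype
  let _ : MetricSpace K := TopologicalSpace.metrizableSpaceMetric K
  -- Parametrizing `K` by the Cantor set in `ℝ` supplies an order in which least preimages exist.
  obtain ⟨h, hc, hs⟩ := exists_nat_bool_continuous_surjective_of_compact K
  let c := cantorSetHomeomorphNatToBool
  obtain ⟨s, hsm, hs'⟩ := exists_measurable_rightInverse_of_isCompact_real
    isCompact_cantorSet ⟨_, (c.symm default).2⟩ (G := fun t => f (h (c t)))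
    (hf.comp (continuous_subtype_val.comp (hc.comp c.continuous)))
  refine ⟨fun z => h (c (s z)), ?_, ?_⟩
  · exact (continuous_subtype_val.comp (hc.comp c.continuous)).measurable.comp hsm
  · rintro _ ⟨σ, hσ, rfl⟩
    obtain ⟨b, hb⟩ := hs ⟨σ, hσ⟩
    refine hs' _ ⟨c.symm b, ?_⟩
    simp [hb]

open Set in
/-- **Jankov–von Neumann selection**, almost everywhere version on Polish spaces. -/
theorem exists_measurable_selection_of_polish {Z E : Type*} [TopologicalSpace Z] [PolishSpace Z]
    [MeasurableSpace Z] [BorelSpace Z] [TopologicalSpace E] [PolishSpace E] [MeasurableSpace E]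
    [BorelSpace E] [Nonempty E] (ν : Measure Z) [IsFiniteMeasure ν] {B : Set (Z × E)}
    (hB : MeasurableSet B) :
    ∃ s : Z → E, Measurable s ∧ ∀ᵐ z ∂ν, (∃ x, (z, x) ∈ B) → (z, s z) ∈ B := by
  classical
  have hA := hB.analyticSet
  rw [AnalyticSet] at hA
  rcases hA with rfl | ⟨F, hF, rfl⟩
  · exact ⟨fun _ => Classical.arbitrary E, measurable_const, by simp⟩
  let f : (ℕ → ℕ) → Z := fun σ => (F σ).1
  have hf : Continuous f := continuous_fst.comp hF
  let _ : MetricSpace Z := TopologicalSpace.metrizableSpaceMetric Z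
  have hK : ∀ n : ℕ, ∃ K : Set (ℕ → ℕ), IsCompact K ∧
      ν (range f) ≤ ν (f '' K) + (n : ENNReal)⁻¹ := fun n =>
    exists_isCompact_measure_range_le ν hf (by simp)
  choose K hK hνK using hK
  choose s hsm hs using fun n => exists_measurable_rightInverse_of_isCompact hf (hK n)
  have hmeas : ∀ n, MeasurableSet (f '' K n) := fun n => ((hK n).image hf).measurableSet
  let A : Set Z := ⋃ n, f '' K n
  have hAm : MeasurableSet A := .iUnion hmeas
  have hAsub : A ⊆ range f := iUnion_subset fun n => image_subset_range _ _
  have hνA : ν (range f) ≤ ν A := by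
    refine ENNReal.le_of_forall_pos_le_add fun ε hε _ => ?_
    obtain ⟨n, hn⟩ := ENNReal.exists_inv_nat_lt (a := (ε : ENNReal)) (by simpa using hε.ne')
    calc ν (range f) ≤ ν (f '' K n) + (n : ENNReal)⁻¹ := hνK n
      _ ≤ ν A + ε := add_le_add (measure_mono (subset_iUnion (fun n => f '' K n) n)) hn.le
  have hnull : ν (range f \ A) = 0 := by
    rw [measure_sdiff hAsub hAm.nullMeasurableSet (measure_ne_top _ _)]
    exact tsub_eq_zero_of_le hνA
  -- The second alternative only makes `Nat.find` total; off `A` the index is `0`.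
  let p : Z → ℕ → Prop := fun z n => z ∈ f '' K n ∨ z ∉ A
  have hp : ∀ z, ∃ n, p z n := fun z => by
    by_cases hz : z ∈ A
    · obtain ⟨n, hn⟩ := mem_iUnion.1 hz
      exact ⟨n, Or.inl hn⟩
    · exact ⟨0, Or.inr hz⟩
  refine ⟨fun z => (F (s (Nat.find (hp z)) z)).2, ?_, ?_⟩
  · refine Measurable.find (f := fun n z => (F (s n z)).2)
      (fun n => (continuous_snd.comp hF).measurable.comp (hsm n)) (fun n => ?_) hp
    exact (hmeas n).union hAm.compl
  · have : ∀ᵐ z ∂ν, z ∉ range f \ A := measure_eq_zero_iff_ae_notMem.1 hnull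
    filter_upwards [this] with z hz
    rintro ⟨x, σ, hσ⟩
    have hzf : z ∈ range f := ⟨σ, by simp [f, hσ]⟩
    have hzA : z ∈ A := by
      by_contra h
      exact hz ⟨hzf, h⟩
    have h1 : z ∈ f '' K (Nat.find (hp z)) := (Nat.find_spec (hp z)).resolve_right (not_not.2 hzA)
    exact ⟨s (Nat.find (hp z)) z, Prod.ext (hs _ z h1) rfl⟩

/-- Countably many sets are jointly pulled back from the product of the Cantor space with the second
factor, as soon as each of them is. -/
theorem exists_measurable_cantor_of_forall {Ω E : Type*} [MeasurableSpace Ω] [MeasurableSpace E]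
    {B : ℕ → Set (Ω × E)}
    (hB : ∀ n, ∃ φ : Ω → ℕ → Bool, Measurable φ ∧ ∃ B' : Set ((ℕ → Bool) × E),
      MeasurableSet B' ∧ B n = Prod.map φ id ⁻¹' B') :
    ∃ φ : Ω → ℕ → Bool, Measurable φ ∧ ∃ B' : ℕ → Set ((ℕ → Bool) × E),
      (∀ n, MeasurableSet (B' n)) ∧ ∀ n, B n = Prod.map φ id ⁻¹' (B' n) := by
  choose φ hφ B' hB' h using hB
  -- All the codes are interleaved into one; `π n` recovers the `n`-th.
  let π : ℕ → (ℕ → Bool) → ℕ → Bool := fun n σ j => σ (Nat.pair n j)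
  have hπ : ∀ n, Measurable (π n) := fun n => by fun_prop
  refine ⟨fun ω k => φ k.unpair.1 ω k.unpair.2, ?_, fun n => Prod.map (π n) id ⁻¹' (B' n),
    fun n => ((hπ n).prodMap measurable_id) (hB' n), fun n => ?_⟩
  · exact measurable_pi_lambda _ fun k => (measurable_pi_apply _).comp (hφ _)
  · rw [h n]
    ext p
    simp [π, Prod.map]

/-- A sequence of sets in a product `σ`-algebra is pulled back from the product of the Cantor space
with the second factor. -/
theorem exists_measurable_cantor {Ω E : Type*} [MeasurableSpace Ω] [MeasurableSpace E]
    {B : ℕ → Set (Ω × E)} (hB : ∀ n, MeasurableSet (B n)) :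
    ∃ φ : Ω → ℕ → Bool, Measurable φ ∧ ∃ B' : ℕ → Set ((ℕ → Bool) × E),
      (∀ n, MeasurableSet (B' n)) ∧ ∀ n, B n = Prod.map φ id ⁻¹' (B' n) := by
  classical
  refine exists_measurable_cantor_of_forall fun n => ?_
  refine MeasurableSpace.induction_on_inter
    (C := fun B _ => ∃ φ : Ω → ℕ → Bool, Measurable φ ∧ ∃ B' : Set ((ℕ → Bool) × E),
      MeasurableSet B' ∧ B = Prod.map φ id ⁻¹' B')
    generateFrom_prod.symm isPiSystem_prod ?_ ?_ ?_ ?_ _ (hB n)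
  · exact ⟨fun _ _ => true, measurable_const, ∅, .empty, by simp⟩
  · rintro _ ⟨F, hF, G, hG, rfl⟩
    refine ⟨fun ω _ => decide (ω ∈ F), measurable_pi_lambda _ fun _ => ?_,
      {p | p.1 0 = true ∧ p.2 ∈ G}, ?_, ?_⟩
    · exact measurable_to_bool (by simpa [Set.preimage] using hF)
    · exact (measurableSet_eq_fun (by fun_prop) measurable_const).inter (measurable_snd hG)
    · ext p
      simp
  · rintro B - ⟨φ, hφ, B', hB', rfl⟩
    exact ⟨φ, hφ, B'ᶜ, hB'.compl, rfl⟩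
  · rintro B - - h
    obtain ⟨φ, hφ, B', hB', h⟩ := exists_measurable_cantor_of_forall h
    exact ⟨φ, hφ, ⋃ n, B' n, .iUnion hB', by simp [h]⟩

/-- **Measurable selection** for sets measurable with respect to the product of a
sub-`σ`-algebra and the Borel `σ`-algebra of a Polish space. -/
theorem exists_measurable_selection {Ω E : Type*} {H mΩ : MeasurableSpace Ω} (hH : H ≤ mΩ)
    (μ : Measure Ω) [IsFiniteMeasure μ] [TopologicalSpace E] [PolishSpace E] [MeasurableSpace E]
    [BorelSpace E] [Nonempty E] {B : Set (Ω × E)} (hB : MeasurableSet[H.prod inferInstance] B) :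
    ∃ s : Ω → E, Measurable[H] s ∧ ∀ᵐ ω ∂μ, (∃ x, (ω, x) ∈ B) → (ω, s ω) ∈ B := by
  -- `Ω` carries no topology. An `H`-measurable code moves the problem to the Cantor space, which is
  -- Polish.
  obtain ⟨φ, hφ, B', hB', h⟩ := @exists_measurable_cantor Ω E H _ (fun _ => B) fun _ => hB
  have : TopologicalSpace.SeparableSpace (ℕ → Bool) :=
    TopologicalSpace.SecondCountableTopology.to_separableSpace
  obtain ⟨s, hs, hae⟩ := exists_measurable_selection_of_polish (μ.map φ) (hB' 0)
  refine ⟨s ∘ φ, hs.comp hφ, ?_⟩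
  filter_upwards [ae_of_ae_map (hφ.mono hH le_rfl).aemeasurable hae] with ω hω
  rw [h 0]
  exact hω

/-! ### Conditional essential infima of random fields -/

open ProbabilityTheory in
/-- An event about `(U, φ)` is null iff its sections are null for the conditional distribution of
`φ` given `U`. -/
theorem ae_notMem_iff_condDistrib_eq_zero {Ω β Z : Type*} [MeasurableSpace Ω] [MeasurableSpace β]
    [MeasurableSpace Z] [StandardBorelSpace Z] [Nonempty Z] (μ : Measure Ω) [IsFiniteMeasure μ]
    {U : Ω → β} (hU : Measurable U) {φ : Ω → Z} (hφ : Measurable φ) {C : Set (β × Z)}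
    (hC : MeasurableSet C) :
    (∀ᵐ ω ∂μ, (U ω, φ ω) ∉ C) ↔
      ∀ᵐ ω ∂μ, condDistrib φ U μ (U ω) (Prod.mk (U ω) ⁻¹' C) = 0 := by
  have hm : Measurable fun b => condDistrib φ U μ b (Prod.mk b ⁻¹' C) :=
    Kernel.measurable_kernel_prodMk_left hC
  have h : μ {ω | (U ω, φ ω) ∈ C} =
      ∫⁻ ω, condDistrib φ U μ (U ω) (Prod.mk (U ω) ⁻¹' C) ∂μ := by
    calc μ {ω | (U ω, φ ω) ∈ C} = μ.map (fun ω => (U ω, φ ω)) C :=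
          (Measure.map_apply (hU.prodMk hφ) hC).symm
      _ = ∫⁻ b, condDistrib φ U μ b (Prod.mk b ⁻¹' C) ∂(μ.map U) := by
          rw [← compProd_map_condDistrib hφ.aemeasurable, Measure.compProd_apply hC]
      _ = _ := lintegral_map hm hU
  refine (measure_eq_zero_iff_ae_notMem (s := {ω | (U ω, φ ω) ∈ C})).symm.trans ?_
  rw [h]
  exact lintegral_eq_zero_iff (hm.comp hU)

open ProbabilityTheory in
/-- A jointly measurable version of the conditional essential infimum given a random element `U`
of a jointly measurable random field `f`. -/
theorem exists_measurable_essInf_given {Ω E β : Type*} [MeasurableSpace Ω] [MeasurableSpace β]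
    [MeasurableSpace E] (μ : Measure Ω) [IsFiniteMeasure μ] {U : Ω → β} (hU : Measurable U)
    {f : Ω → E → EReal} (hf : Measurable fun p : Ω × E => f p.1 p.2) :
    ∃ η : β → E → EReal, Measurable (fun p : β × E => η p.1 p.2) ∧
      ∀ γ : β → E, Measurable γ →
        (∀ᵐ ω ∂μ, η (U ω) (γ (U ω)) ≤ f ω (γ (U ω))) ∧
        ∀ g : β → EReal, Measurable g → (∀ᵐ ω ∂μ, g (U ω) ≤ f ω (γ (U ω))) →
          ∀ᵐ ω ∂μ, g (U ω) ≤ η (U ω) (γ (U ω)) := by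
  classical
  obtain ⟨q, hq⟩ := exists_surjective_nat ℚ
  obtain ⟨φ, hφ, B, hB, hfB⟩ := exists_measurable_cantor
    (B := fun n => {p : Ω × E | ((q n : ℝ) : EReal) ≤ f p.1 p.2})
    fun n => measurableSet_le measurable_const hf
  have hfB' : ∀ n ω x, ((q n : ℝ) : EReal) ≤ f ω x ↔ (φ ω, x) ∈ B n := fun n ω x =>
    Set.ext_iff.1 (hfB n) (ω, x)
  let κ := condDistrib φ U μ
  -- `f` depends on `ω` only through the Cantor-valued code `φ`, so a regular conditional
  -- distribution exists for arbitrary `Ω`. `G n` consists of the `(b, x)` for which `f ≥ q n` has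
  -- conditional probability one, and `η` is the supremum of the `q n` allowed there.
  let G : ℕ → Set (β × E) := fun n => {p | κ p.1 {z | (z, p.2) ∉ B n} = 0}
  have hG : ∀ n, MeasurableSet (G n) := by
    intro n
    have ht : MeasurableSet {p : (β × E) × (ℕ → Bool) | (p.2, p.1.2) ∉ B n} :=
      ((measurable_snd.prodMk (measurable_snd.comp measurable_fst)) (hB n)).compl
    have := Kernel.measurable_kernel_prodMk_left (κ := Kernel.prodMkRight E κ) ht
    exact this (measurableSet_singleton 0)
  refine ⟨fun b x => ⨆ n, if (b, x) ∈ G n then ((q n : ℝ) : EReal) else ⊥,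
    Measurable.iSup fun n => Measurable.ite (hG n) measurable_const measurable_const,
    fun γ hγ => ⟨?_, fun g hg hgf => ?_⟩⟩
  · have h : ∀ n, ∀ᵐ ω ∂μ, (U ω, γ (U ω)) ∈ G n → (φ ω, γ (U ω)) ∈ B n := by
      intro n
      have hC : MeasurableSet {p : β × (ℕ → Bool) | (p.1, γ p.1) ∈ G n ∧ (p.2, γ p.1) ∉ B n} :=
        ((measurable_fst.prodMk (hγ.comp measurable_fst)) (hG n)).inter
          ((measurable_snd.prodMk (hγ.comp measurable_fst)) (hB n)).compl
      have := (ae_notMem_iff_condDistrib_eq_zero μ hU hφ hC).2 (.of_forall fun ω => by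
        by_cases hω : (U ω, γ (U ω)) ∈ G n
        · refine measure_mono_null (fun z hz => hz.2) hω
        · convert measure_empty (μ := condDistrib φ U μ (U ω))
          ext z
          simp [hω])
      filter_upwards [this] with ω hω h1
      by_contra h2
      exact hω ⟨h1, h2⟩
    filter_upwards [ae_all_iff.2 h] with ω hω
    refine iSup_le fun n => ?_
    split_ifs with hn
    · exact (hfB' n ω _).2 (hω n hn)
    · exact bot_le
  · have h : ∀ n, ∀ᵐ ω ∂μ, ((q n : ℝ) : EReal) ≤ g (U ω) → (U ω, γ (U ω)) ∈ G n := by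
      intro n
      have hC : MeasurableSet
          {p : β × (ℕ → Bool) | ((q n : ℝ) : EReal) ≤ g p.1 ∧ (p.2, γ p.1) ∉ B n} :=
        (measurableSet_le measurable_const (hg.comp measurable_fst)).inter
          ((measurable_snd.prodMk (hγ.comp measurable_fst)) (hB n)).compl
      have := (ae_notMem_iff_condDistrib_eq_zero μ hU hφ hC).1 (by
        filter_upwards [hgf] with ω hω hmem
        exact hmem.2 ((hfB' n ω _).1 (hmem.1.trans hω)))
      filter_upwards [this] with ω hω h1
      change κ (U ω) {z | (z, γ (U ω)) ∉ B n} = 0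
      refine measure_mono_null ?_ hω
      exact fun z hz => ⟨h1, hz⟩
    filter_upwards [ae_all_iff.2 h] with ω hω
    by_contra! hlt
    obtain ⟨r, hr1, hr2⟩ := EReal.lt_iff_exists_rat_btwn.1 hlt
    obtain ⟨n, rfl⟩ := hq r
    refine absurd hr1 (not_lt.2 ?_)
    refine le_iSup_of_le n ?_
    rw [if_pos (hω n hr2.le)]

/-- A jointly measurable random field has a jointly measurable conditional essential infimum. -/
theorem exists_isCondEssInfField {Ω E : Type*} {H mΩ : MeasurableSpace Ω} (hH : H ≤ mΩ)
    [MeasurableSpace E] (μ : Measure Ω) [IsFiniteMeasure μ] {f : Ω → E → EReal}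
    (hf : Measurable fun p : Ω × E => f p.1 p.2) : ∃ η, IsCondEssInfField H μ f η := by
  -- Conditioning on `H` is conditioning on the identity from `(Ω, mΩ)` to `(Ω, H)`.
  obtain ⟨η, hη, h⟩ := @exists_measurable_essInf_given Ω E Ω mΩ H _ μ _ id
    (measurable_id'' hH) f hf
  refine ⟨η, hη, fun γ hγ => ⟨?_, (h γ hγ).1, (h γ hγ).2⟩⟩
  exact hη.comp (measurable_id.prodMk hγ)

/-- Conditional essential infimum fields depend on the field only up to a null event. -/
theorem IsCondEssInfField.congr_ae {Ω E : Type*} {H mΩ : MeasurableSpace Ω} [MeasurableSpace E]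
    {μ : Measure Ω} {f f' η : Ω → E → EReal} (h : IsCondEssInfField H μ f η)
    (hff' : ∀ᵐ ω ∂μ, f ω = f' ω) : IsCondEssInfField H μ f' η := by
  refine ⟨h.1, fun γ hγ => ⟨(h.2 γ hγ).1, ?_, fun g hg hgf => (h.2 γ hγ).2.2 g hg ?_⟩⟩
  · filter_upwards [(h.2 γ hγ).2.1, hff'] with ω h1 h2
    rwa [← h2]
  · filter_upwards [hgf, hff'] with ω h1 h2
    rwa [h2]

/-! ### Selections and inclusion of random sets -/

/-- An `H`-measurable random set is a.s. contained in another one if every `H`-measurable random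
point a.s. belongs to the second set whenever it belongs to the first. -/
theorem IsRandomSet.ae_subset {Ω E : Type*} {H mΩ : MeasurableSpace Ω} (hH : H ≤ mΩ)
    {μ : Measure Ω} [IsFiniteMeasure μ] [TopologicalSpace E] [PolishSpace E] [MeasurableSpace E]
    [BorelSpace E] [Nonempty E] {Y S : Ω → Set E} (hY : IsRandomSet H Y) (hS : IsRandomSet H S)
    (h : ∀ γ : Ω → E, Measurable[H] γ → ∀ᵐ ω ∂μ, γ ω ∈ Y ω → γ ω ∈ S ω) :
    ∀ᵐ ω ∂μ, Y ω ⊆ S ω := by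
  obtain ⟨s, hs, hsel⟩ := exists_measurable_selection hH μ (MeasurableSet.diff hY hS)
  filter_upwards [hsel, h s hs] with ω h1 h2 x hx
  by_contra hxS
  have := h1 ⟨x, hx, hxS⟩
  exact this.2 (h2 this.1)

/-- A random set has countably many measurable selections that witness all intersections with
open sets. -/
theorem IsRandomSet.exists_selections {Ω E : Type*} {H mΩ : MeasurableSpace Ω} (hH : H ≤ mΩ)
    (μ : Measure Ω) [IsFiniteMeasure μ] [TopologicalSpace E] [PolishSpace E] [MeasurableSpace E]
    [BorelSpace E] [Nonempty E] {Y : Ω → Set E} (hY : IsRandomSet H Y) :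
    ∃ s : ℕ → Ω → E, (∀ n, Measurable[H] (s n)) ∧
      ∀ᵐ ω ∂μ, ∀ x ∈ Y ω, ∀ U ∈ nhds x, ∃ n, s n ω ∈ Y ω ∧ s n ω ∈ U := by
  have hbasis := TopologicalSpace.isBasis_countableBasis E
  obtain ⟨V₀, hV₀, -⟩ := hbasis.mem_nhds_iff.1 (Filter.univ_mem (f := nhds (Classical.arbitrary E)))
  obtain ⟨b, hb⟩ := (TopologicalSpace.countable_countableBasis E).exists_eq_range ⟨V₀, hV₀⟩
  have hbm : ∀ n, MeasurableSet (b n) := fun n =>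
    (TopologicalSpace.isOpen_of_mem_countableBasis (hb ▸ Set.mem_range_self n)).measurableSet
  have hB : ∀ n, MeasurableSet[H.prod inferInstance] {p : Ω × E | p.2 ∈ Y p.1 ∧ p.2 ∈ b n} :=
    fun n => MeasurableSet.inter hY (@measurable_snd Ω E H _ _ (hbm n))
  choose s hs hsel using fun n => exists_measurable_selection hH μ (hB n)
  refine ⟨s, hs, ?_⟩
  filter_upwards [ae_all_iff.2 hsel] with ω hω x hx U hU
  obtain ⟨V, hV, hxV, hVU⟩ := hbasis.mem_nhds_iff.1 hU
  rw [hb] at hV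
  obtain ⟨n, rfl⟩ := hV
  have := hω n ⟨x, hx, hxV⟩
  exact ⟨n, this.1, hVU this.2⟩

/-- Variant of `IsRandomSet.ae_subset` in which the larger set has closed values and need not be
`H`-measurable. -/
theorem IsRandomSet.ae_subset_of_isClosed {Ω E : Type*} {H mΩ : MeasurableSpace Ω} (hH : H ≤ mΩ)
    {μ : Measure Ω} [IsFiniteMeasure μ] [TopologicalSpace E] [PolishSpace E] [MeasurableSpace E]
    [BorelSpace E] [Nonempty E] {Y S : Ω → Set E} (hY : IsRandomSet H Y)
    (hS : ∀ᵐ ω ∂μ, IsClosed (S ω))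
    (h : ∀ γ : Ω → E, Measurable[H] γ → ∀ᵐ ω ∂μ, γ ω ∈ Y ω → γ ω ∈ S ω) :
    ∀ᵐ ω ∂μ, Y ω ⊆ S ω := by
  -- `Y \ S` may fail to be `H`-measurable, so selections dense in `Y` are tested and closedness of
  -- `S` gives the rest.
  obtain ⟨s, hs, hsel⟩ := hY.exists_selections hH μ
  filter_upwards [hsel, ae_all_iff.2 fun n => h (s n) (hs n), hS] with ω h1 h2 h3 x hx
  rw [← h3.closure_eq, mem_closure_iff_nhds]
  intro U hU
  obtain ⟨n, hn, hnU⟩ := h1 x hx U hU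
  exact ⟨_, hnU, h2 n hn⟩

/-- **Castaing representation** of an a.s. non-empty random set. -/
theorem IsRandomSet.exists_castaing {Ω E : Type*} [MeasurableSpace Ω] (μ : Measure Ω)
    [IsFiniteMeasure μ] [TopologicalSpace E] [PolishSpace E] [MeasurableSpace E] [BorelSpace E]
    [Nonempty E] {X : Ω → Set E} (hX : IsRandomSet inferInstance X)
    (hne : ∀ᵐ ω ∂μ, (X ω).Nonempty) :
    ∃ γ : ℕ → Ω → E, (∀ n, Measurable (γ n)) ∧
      ∀ᵐ ω ∂μ, (∀ n, γ n ω ∈ X ω) ∧ X ω ⊆ closure (Set.range fun n => γ n ω) := by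
  classical
  obtain ⟨s, hs, hsel⟩ := hX.exists_selections le_rfl μ
  obtain ⟨t, ht, htsel⟩ := exists_measurable_selection le_rfl μ hX
  have hmem : ∀ n, MeasurableSet {ω | s n ω ∈ X ω} := fun n =>
    (measurable_id.prodMk (hs n)) hX
  refine ⟨fun n ω => if s n ω ∈ X ω then s n ω else t ω,
    fun n => Measurable.ite (hmem n) (hs n) ht, ?_⟩
  filter_upwards [hsel, htsel, hne] with ω h1 h2 h3
  refine ⟨fun n => ?_, fun x hx => ?_⟩
  · split_ifs with h
    exacts [h, h2 h3]
  · rw [mem_closure_iff_nhds]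
    intro U hU
    obtain ⟨n, hn, hnU⟩ := h1 x hx U hU
    exact ⟨s n ω, hnU, n, by simp [hn]⟩

/-! ### Support functions -/

section SupportFunction

variable {E : Type*} [NormedAddCommGroup E] [NormedSpace ℝ E]

theorem le_supportFn {A : Set E} {x : E} (hx : x ∈ A) (u : E →L[ℝ] ℝ) :
    ((u x : ℝ) : EReal) ≤ supportFn A u :=
  le_iSup₂_of_le x hx le_rfl

theorem supportFn_le_iff {A : Set E} {u : E →L[ℝ] ℝ} {c : EReal} :
    supportFn A u ≤ c ↔ ∀ x ∈ A, ((u x : ℝ) : EReal) ≤ c :=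
  iSup₂_le_iff

/-- The support function is the supremum over a dense sequence. -/
theorem supportFn_eq_iSup {A : Set E} {γ : ℕ → E} (hγ : ∀ n, γ n ∈ A)
    (hA : A ⊆ closure (Set.range γ)) (u : E →L[ℝ] ℝ) :
    supportFn A u = ⨆ n, ((u (γ n) : ℝ) : EReal) := by
  refine le_antisymm (supportFn_le_iff.2 fun x hx => ?_) (iSup_le fun n => le_supportFn (hγ n) u)
  have hcl : IsClosed {y : E | ((u y : ℝ) : EReal) ≤ ⨆ n, ((u (γ n) : ℝ) : EReal)} :=
    isClosed_le (continuous_coe_real_ereal.comp u.continuous) continuous_const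
  exact closure_minimal (Set.range_subset_iff.2 fun n =>
    le_iSup (fun n => ((u (γ n) : ℝ) : EReal)) n) hcl (hA hx)

/-- The subtracted term is real, so `∞ - ∞` never occurs. -/
theorem supportGap_nonneg_iff {Ω : Type*} {X : Ω → Set E} {ζ : Ω → E →L[ℝ] ℝ} {ω : Ω} {x : E} :
    0 ≤ supportGap X ζ ω x ↔ ((ζ ω x : ℝ) : EReal) ≤ supportFn (X ω) (ζ ω) :=
  EReal.sub_nonneg (by simp) (by simp)

theorem isRandomDual_const {Ω : Type*} (m : MeasurableSpace Ω) (u : E →L[ℝ] ℝ) :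
    IsRandomDual m fun _ : Ω => u :=
  fun _ => measurable_const

/-- The conditional essential infimum of the support function is the value at zero of the field
of the support gap. -/
theorem IsCondEssInfField.isCondEssInf_supportFn {Ω : Type*} {H mΩ : MeasurableSpace Ω}
    [MeasurableSpace E] {μ : Measure Ω} {X : Ω → Set E} {ζ : Ω → E →L[ℝ] ℝ} {η : Ω → E → EReal}
    (hη : IsCondEssInfField H μ (supportGap X ζ) η) :
    IsCondEssInf H μ (fun ω => supportFn (X ω) (ζ ω)) fun ω => η ω 0 := by
  simpa [supportGap] using hη.2 (fun _ => 0) measurable_const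

variable [TopologicalSpace.SeparableSpace E] [MeasurableSpace E] [BorelSpace E]

/-- The evaluation of a random element of the dual is jointly measurable. -/
theorem IsRandomDual.measurable_uncurry {Ω : Type*} [MeasurableSpace Ω] {ζ : Ω → E →L[ℝ] ℝ}
    (hζ : IsRandomDual inferInstance ζ) : Measurable fun p : Ω × E => ζ p.1 p.2 := by
  have : SecondCountableTopology E := UniformSpace.secondCountable_of_separable E
  exact (measurable_uncurry_of_continuous_of_measurable (u := fun x ω => ζ ω x)
    (fun ω => (ζ ω).continuous) hζ).comp measurable_swap

variable [CompleteSpace E]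

/-- The support gap of a random set has a conditional essential infimum field. -/
theorem exists_isCondEssInfField_supportGap {Ω : Type*} {H mΩ : MeasurableSpace Ω} (hH : H ≤ mΩ)
    (μ : Measure Ω) [IsFiniteMeasure μ] {X : Ω → Set E} (hX : IsRandomSet mΩ X)
    (hne : ∀ᵐ ω ∂μ, (X ω).Nonempty) {ζ : Ω → E →L[ℝ] ℝ} (hζ : IsRandomDual mΩ ζ) :
    ∃ η, IsCondEssInfField H μ (supportGap X ζ) η := by
  obtain ⟨γ, hγ, hcast⟩ := hX.exists_castaing μ hne
  have hev := hζ.measurable_uncurry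
  -- A Castaing sequence turns the support function into a countable supremum, up to a null event.
  have hf : Measurable fun p : Ω × E =>
      (⨆ n, ((ζ p.1 (γ n p.1) : ℝ) : EReal)) - ((ζ p.1 p.2 : ℝ) : EReal) := by
    refine Measurable.add (Measurable.iSup fun n => ?_) hev.neg.coe_real_ereal
    exact (hev.comp (measurable_fst.prodMk ((hγ n).comp measurable_fst))).coe_real_ereal
  obtain ⟨η, hη⟩ := exists_isCondEssInfField hH μ
    (f := fun ω x => (⨆ n, ((ζ ω (γ n ω) : ℝ) : EReal)) - ((ζ ω x : ℝ) : EReal)) hf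
  refine ⟨η, hη.congr_ae ?_⟩
  filter_upwards [hcast] with ω hω
  ext x
  simp only [supportGap]
  rw [supportFn_eq_iSup hω.1 hω.2]

end SupportFunction

/-! ### Representation by countably many random half-spaces -/

section HalfspaceRepresentation

variable {E : Type*} [NormedAddCommGroup E] [NormedSpace ℝ E]

/-- An open ball disjoint from a convex set is separated from it by a functional of norm at most
one, with a gap of the size of the radius. -/
theorem exists_norm_le_one_le_sub_of_disjoint_ball {A : Set E} (hA : Convex ℝ A) {c : E} {r : ℝ}
    (hr : 0 < r) (hd : Disjoint (Metric.ball c r) A) :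
    ∃ u : E →L[ℝ] ℝ, ‖u‖ ≤ 1 ∧ ∀ y ∈ A, u y ≤ u c - r := by
  obtain ⟨f, b, hfb, hbA⟩ := geometric_hahn_banach_open (convex_ball c r) Metric.isOpen_ball hA hd
  have hcl : ∀ a ∈ Metric.closedBall c r, f a ≤ b := by
    intro a ha
    rw [← closure_ball c hr.ne'] at ha
    exact closure_minimal (fun a ha => (hfb a ha).le)
      (isClosed_le f.continuous continuous_const) ha
  have hM : 0 < b - f c := sub_pos.2 (hfb c (Metric.mem_ball_self hr))
  have hnorm : ‖f‖ ≤ (b - f c) / r := by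
    refine f.opNorm_le_of_unit_norm (by positivity) fun x hx => ?_
    have h1 := hcl (c + r • x) (by simp [norm_smul, hx, abs_of_pos hr])
    have h2 := hcl (c - r • x) (by simp [norm_smul, hx, abs_of_pos hr])
    simp only [map_add, map_sub, map_smul, smul_eq_mul] at h1 h2
    rw [Real.norm_eq_abs, abs_le, ← neg_div, div_le_iff₀ hr, le_div_iff₀ hr]
    constructor <;> linarith [mul_comm r (f x)]
  -- `f` is larger on `A` than on the ball, hence the sign; the factor offsets `‖f‖ ≤ (b - f c) /
  -- r`.
  refine ⟨-(r / (b - f c)) • f, ?_, fun y hy => ?_⟩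
  · rw [norm_smul, norm_neg, Real.norm_eq_abs, abs_of_pos (by positivity)]
    calc r / (b - f c) * ‖f‖ ≤ r / (b - f c) * ((b - f c) / r) := by gcongr
      _ = 1 := by field_simp
  · have h := hbA y hy
    simp only [FunLike.coe_smul, Pi.smul_apply, smul_eq_mul]
    have h1 : r / (b - f c) * (b - f c) = r := by field_simp
    have h2 : r / (b - f c) * b ≤ r / (b - f c) * f y := by gcongr
    linarith

variable [CompleteSpace E] [TopologicalSpace.SeparableSpace E] [MeasurableSpace E] [BorelSpace E]

open Set in
/-- A measurable random set with non-empty closed convex values is the intersection of countably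
many random half-spaces. -/
theorem exists_isHalfspaceRep {Ω : Type*} {mΩ : MeasurableSpace Ω} (μ : Measure Ω)
    [IsFiniteMeasure μ] {X : Ω → Set E} (hX : IsRandomSet mΩ X)
    (hne : ∀ᵐ ω ∂μ, (X ω).Nonempty) (hcl : ∀ᵐ ω ∂μ, IsClosed (X ω))
    (hconv : ∀ᵐ ω ∂μ, Convex ℝ (X ω)) :
    ∃ ζ : ℕ → Ω → E →L[ℝ] ℝ, IsHalfspaceRep μ X ζ := by
  obtain ⟨γ, hγ, hcast⟩ := hX.exists_castaing μ hne
  -- The dual may be non-separable in norm, but its weak-star unit ball is compact and metrizable,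
  -- so selection applies.
  let W : Set (WeakDual ℝ E) := WeakDual.toStrongDual ⁻¹' Metric.closedBall 0 1
  have hWc : IsCompact W := WeakDual.isCompact_closedBall 0 1
  have : CompactSpace W := isCompact_iff_compactSpace.1 hWc
  have : TopologicalSpace.MetrizableSpace W := WeakDual.metrizable_of_isCompact ℝ E W hWc
  let _ : MetricSpace W := TopologicalSpace.metrizableSpaceMetric W
  let _ : MeasurableSpace W := borel W
  have : BorelSpace W := ⟨rfl⟩
  have : Nonempty W := ⟨⟨0, by simp [W]⟩⟩
  have hevc : ∀ x : E, Continuous fun w : W => w.1 x := fun x =>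
    (WeakDual.eval_continuous x).comp continuous_subtype_val
  have hev : ∀ ξ : Ω → E, Measurable ξ → Measurable fun p : Ω × W => p.2.1 (ξ p.1) := by
    intro ξ hξ
    exact (measurable_uncurry_of_continuous_of_measurable (u := fun (w : W) ω => w.1 (ξ ω))
      (fun ω => hevc (ξ ω))
      fun w => (WeakDual.toStrongDual w.1).continuous.measurable.comp hξ).comp measurable_swap
  let x := TopologicalSpace.denseSeq E
  let r : ℕ → ℝ := fun n => 1 / (n + 1)
  -- The functionals sought separate `X` from the ball of radius `r n` about `x k`, with gap `r n`.
  have hB : ∀ k n : ℕ, MeasurableSet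
      {p : Ω × W | ∀ j, p.2.1 (γ j p.1) ≤ p.2.1 (x k) - r n} := by
    intro k n
    simp only [ofPred_forall]
    exact .iInter fun j => measurableSet_le (hev _ (hγ j))
      ((hev _ measurable_const).sub measurable_const)
  choose s hs hsel using fun k n => exists_measurable_selection le_rfl μ (hB k n)
  refine ⟨fun i ω => WeakDual.toStrongDual (s i.unpair.1 i.unpair.2 ω).1, fun i y => ?_, ?_⟩
  · exact (hevc y).measurable.comp (hs i.unpair.1 i.unpair.2)
  filter_upwards [hcast, hcl, hconv, ae_all_iff.2 fun k => ae_all_iff.2 (hsel k)]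
    with ω h1 h3 h4 h5
  -- Where no separating functional exists the selected value is arbitrary; this is harmless, as `X`
  -- lies in each of its supporting half-spaces.
  refine Subset.antisymm (fun y hy => mem_iInter.2 fun i => le_supportFn hy _) fun y hy => ?_
  by_contra hyX
  obtain ⟨δ, hδ, hball⟩ := Metric.isOpen_iff.1 h3.isOpen_compl y hyX
  obtain ⟨n, hn⟩ := exists_nat_one_div_lt (half_pos hδ)
  have hr : 0 < r n := Nat.one_div_pos_of_nat
  obtain ⟨k, hk⟩ := (TopologicalSpace.denseRange_denseSeq E).exists_dist_lt y hr
  have hdisj : Disjoint (Metric.ball (x k) (r n)) (X ω) := by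
    refine disjoint_left.2 fun z hz hzX => hball ?_ hzX
    have h6 : dist z (x k) < r n := hz
    have h7 : dist (x k) y < r n := dist_comm y (x k) ▸ hk
    have h8 : r n < δ / 2 := hn
    rw [Metric.mem_ball]
    linarith [dist_triangle z (x k) y]
  obtain ⟨u, hu1, hu2⟩ := exists_norm_le_one_le_sub_of_disjoint_ball h4 hr hdisj
  have hw := h5 k n ⟨⟨StrongDual.toWeakDual u, by simpa [W] using hu1⟩,
    fun j => hu2 _ (h1.1 j)⟩
  set v : E →L[ℝ] ℝ := WeakDual.toStrongDual (s k n ω).1 with hv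
  have hw' : ∀ j, v (γ j ω) ≤ v (x k) - r n := hw
  have hv1 : ‖v‖ ≤ 1 := mem_closedBall_zero_iff.1 (s k n ω).2
  have hle : supportFn (X ω) v ≤ ((v (x k) - r n : ℝ) : EReal) := by
    rw [supportFn_eq_iSup h1.1 h1.2]
    exact iSup_le fun j => EReal.coe_le_coe_iff.2 (hw' j)
  have hyv : ((v y : ℝ) : EReal) ≤ supportFn (X ω) v := by
    have := mem_iInter.1 hy (Nat.pair k n)
    simpa [hv] using this
  have h9 : v y ≤ v (x k) - r n := EReal.coe_le_coe_iff.1 (hyv.trans hle)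
  have h10 : v (x k) - v y ≤ dist y (x k) := by
    rw [← map_sub, dist_comm, dist_eq_norm]
    exact (le_abs_self _).trans ((v.le_opNorm _).trans
      (mul_le_of_le_one_left (norm_nonneg _) hv1))
  linarith

end HalfspaceRepresentation

/-! ### Weakly compact convex sets -/

section WeaklyCompact

variable {E : Type*} [NormedAddCommGroup E] [NormedSpace ℝ E]

theorem continuous_apply_toWeakSpace_symm (u : E →L[ℝ] ℝ) :
    Continuous fun y : WeakSpace ℝ E => u ((toWeakSpace ℝ E).symm y) :=
  WeakBilin.eval_continuous (topDualPairing ℝ E).flip u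

theorem IsWeaklyCompact.isCompact_image_pi {A : Set E} (hA : IsWeaklyCompact A) {ι : Type*}
    (u : ι → E →L[ℝ] ℝ) : IsCompact ((fun x i => u i x) '' A) := by
  have := hA.image (continuous_pi fun i => continuous_apply_toWeakSpace_symm (u i))
  simpa [Set.image_image] using this

/-- Each functional is bounded on `A`; the uniform boundedness principle applies to `A` embedded in
the bidual. -/
theorem IsWeaklyCompact.exists_norm_le {A : Set E} (hA : IsWeaklyCompact A) :
    ∃ C, 0 ≤ C ∧ ∀ x ∈ A, ‖x‖ ≤ C := by
  obtain ⟨C, hC⟩ := banach_steinhaus (𝕜 := ℝ) (E := StrongDual ℝ E)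
    (g := fun x : A => NormedSpace.inclusionInDoubleDual ℝ E x) fun u => by
      have h := hA.image (continuous_apply_toWeakSpace_symm u)
      obtain ⟨C, hC⟩ := h.isBounded.exists_norm_le
      exact ⟨C, fun x => hC _ ⟨_, ⟨x, x.2, rfl⟩, by simp⟩⟩
  refine ⟨max C 0, le_max_right _ _, fun x hx => le_max_of_le_left ?_⟩
  rw [← (NormedSpace.inclusionInDoubleDualLi ℝ).norm_map x]
  exact hC ⟨x, hx⟩

/-- A weakly compact convex set is determined by the values of its support function on any
separating subspace of the dual. -/
theorem IsWeaklyCompact.mem_of_forall_le_supportFn {A : Set E} (hA : IsWeaklyCompact A)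
    (hconv : Convex ℝ A) {V : Submodule ℝ (E →L[ℝ] ℝ)} (hV : ∀ x : E, (∀ u ∈ V, u x = 0) → x = 0)
    {x : E} (hx : ∀ u ∈ V, ((u x : ℝ) : EReal) ≤ supportFn A u) : x ∈ A := by
  by_contra hxA
  -- Separation in `E` could give a functional outside `V`. By compactness finitely many elements of
  -- `V` already distinguish `x` from all of `A`, so separation is done in `ℝ^F` and pulls back to a
  -- combination of them.
  obtain ⟨F, hF⟩ := IsCompact.elim_finite_subfamily_closed hA
    (fun u : V => {y : WeakSpace ℝ E | u.1 ((toWeakSpace ℝ E).symm y) = u.1 x})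
    (fun u => isClosed_eq (continuous_apply_toWeakSpace_symm u.1) continuous_const) (by
      rw [Set.eq_empty_iff_forall_notMem]
      rintro _ ⟨⟨y, hy, rfl⟩, h⟩
      have : y - x = 0 := hV _ fun u hu => by
        have := Set.mem_iInter.1 h ⟨u, hu⟩
        simpa [sub_eq_zero] using this
      exact hxA (sub_eq_zero.1 this ▸ hy))
  let T : E →ₗ[ℝ] F → ℝ := LinearMap.pi fun i => (i.1.1 : E →L[ℝ] ℝ).toLinearMap
  have hT : ∀ y i, T y i = i.1.1 y := fun _ _ => rfl
  have hTA : IsCompact (T '' A) := hA.isCompact_image_pi fun i : F => i.1.1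
  have hTx : T x ∉ T '' A := by
    rintro ⟨y, hy, hyx⟩
    refine (Set.eq_empty_iff_forall_notMem.1 hF) (toWeakSpace ℝ E y) ⟨⟨y, hy, rfl⟩, ?_⟩
    simp only [Set.mem_iInter]
    intro u hu
    have := congrFun hyx ⟨u, hu⟩
    simpa [hT] using this
  obtain ⟨f, b, hfb, hbx⟩ := geometric_hahn_banach_closed_point (hconv.linear_image T)
    hTA.isClosed hTx
  classical
  let u : E →L[ℝ] ℝ := ∑ i : F, f (fun j => if i = j then 1 else 0) • i.1.1
  have hu : ∀ y, u y = f (T y) := by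
    intro y
    have := LinearMap.pi_apply_eq_sum_univ f.toLinearMap (T y)
    simp only [ContinuousLinearMap.coe_coe] at this
    rw [this]
    simp [u, hT, mul_comm]
  have huV : u ∈ V := V.sum_mem fun i _ => V.smul_mem _ i.1.2
  have h1 : supportFn A u ≤ (b : EReal) := supportFn_le_iff.2 fun y hy =>
    EReal.coe_le_coe_iff.2 (hu y ▸ (hfb _ ⟨y, hy, rfl⟩).le)
  have h2 := EReal.coe_le_coe_iff.1 ((hx u huV).trans h1)
  rw [hu] at h2
  exact absurd hbx (not_lt.2 h2)

/-- For a bounded set, the half-space inequalities pass to norm limits of functionals. -/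
theorem le_supportFn_of_mem_closure {A : Set E} {C : ℝ} (hC : 0 ≤ C) (hA : ∀ y ∈ A, ‖y‖ ≤ C)
    {D : Set (E →L[ℝ] ℝ)} {x : E} (hD : ∀ u ∈ D, ((u x : ℝ) : EReal) ≤ supportFn A u)
    {u : E →L[ℝ] ℝ} (hu : u ∈ closure D) : ((u x : ℝ) : EReal) ≤ supportFn A u := by
  by_contra! hlt
  obtain ⟨c, hc1, hc2⟩ := EReal.lt_iff_exists_real_btwn.1 hlt
  have hcx : 0 < u x - c := sub_pos.2 (EReal.coe_lt_coe_iff.1 hc2)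
  -- Replacing `u` by `v` costs at most `ε * C` on `A` and `ε * ‖x‖` at `x`; the `1` keeps the
  -- divisor positive.
  have hpos : 0 < C + ‖x‖ + 1 := by positivity
  obtain ⟨v, hv, huv⟩ := Metric.mem_closure_iff.1 hu _ (div_pos hcx hpos)
  rw [dist_eq_norm] at huv
  set ε := ‖u - v‖ with hε
  have hε' : ε * (C + ‖x‖ + 1) < u x - c := (lt_div_iff₀ hpos).1 huv
  have hε0 : 0 ≤ ε := norm_nonneg _
  have hbound : ∀ y, |u y - v y| ≤ ε * ‖y‖ := fun y => (u - v).le_opNorm y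
  have h1 : supportFn A v ≤ ((c + ε * C : ℝ) : EReal) := supportFn_le_iff.2 fun y hy => by
    have h2 : u y ≤ c := EReal.coe_le_coe_iff.1 ((le_supportFn hy u).trans hc1.le)
    have h3 : ε * ‖y‖ ≤ ε * C := mul_le_mul_of_nonneg_left (hA y hy) hε0
    have h4 := (abs_le.1 (hbound y)).1
    exact EReal.coe_le_coe_iff.2 (by linarith)
  have h5 : v x ≤ c + ε * C := EReal.coe_le_coe_iff.1 ((hD v hv).trans h1)
  have h6 := (abs_le.1 (hbound x)).2
  linarith

/-- The half-spaces of a countable total set of functionals determine a weakly compact convex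
set. -/
theorem IsWeaklyCompact.mem_of_isCountableTotal {A : Set E} (hA : IsWeaklyCompact A)
    (hconv : Convex ℝ A) {D : Set (E →L[ℝ] ℝ)} (hD : IsCountableTotal D) {x : E}
    (hx : ∀ u ∈ D, ((u x : ℝ) : EReal) ≤ supportFn A u) : x ∈ A := by
  obtain ⟨-, V, hV, hVD⟩ := hD
  obtain ⟨C, hC, hAC⟩ := hA.exists_norm_le
  exact hA.mem_of_forall_le_supportFn hconv hV fun u hu =>
    le_supportFn_of_mem_closure hC hAC hx (hVD hu)

/-- Norming functionals of a dense sequence separate points, and their span is norm separable even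
if the dual is not. -/
theorem exists_isCountableTotal (E : Type*) [NormedAddCommGroup E] [NormedSpace ℝ E]
    [TopologicalSpace.SeparableSpace E] : ∃ D : Set (E →L[ℝ] ℝ), IsCountableTotal D := by
  let x := TopologicalSpace.denseSeq E
  choose g hg1 hg2 using fun n => exists_dual_vector'' ℝ (x n)
  let V : Submodule ℝ (E →L[ℝ] ℝ) := Submodule.span ℝ (Set.range g)
  have hsep : TopologicalSpace.IsSeparable (V : Set (E →L[ℝ] ℝ)) :=
    (Set.countable_range g).isSeparable.span
  obtain ⟨D, hD, hVD⟩ := hsep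
  refine ⟨D, hD, V, fun y hy => ?_, hVD⟩
  by_contra hy0
  obtain ⟨n, hn⟩ := (TopologicalSpace.denseRange_denseSeq E).exists_dist_lt y
    (half_pos (norm_pos_iff.2 hy0))
  have h1 : g n y = 0 := hy _ (Submodule.subset_span ⟨n, rfl⟩)
  have h2 : ‖x n‖ ≤ ‖x n - y‖ := by
    calc ‖x n‖ = g n (x n - y) := by rw [map_sub, h1, sub_zero, hg2]; rfl
      _ ≤ ‖g n‖ * ‖x n - y‖ := (le_abs_self _).trans ((g n).le_opNorm _)
      _ ≤ ‖x n - y‖ := mul_le_of_le_one_left (norm_nonneg _) (hg1 n)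
  have h3 : ‖x n - y‖ < ‖y‖ / 2 := by rwa [norm_sub_rev, ← dist_eq_norm]
  have h4 : ‖y‖ ≤ ‖x n‖ + ‖x n - y‖ := by
    simpa using norm_sub_le (x n) (x n - y)
  linarith

end WeaklyCompact

/-! ### The conditional core -/

section ConditionalCore

variable {Ω E : Type*} {H mΩ : MeasurableSpace Ω} {μ : Measure Ω}

theorem IsCondCore.ae_eq [MeasurableSpace E] {X M N : Ω → Set E} (hM : IsCondCore H μ X M)
    (hN : IsCondCore H μ X N) : ∀ᵐ ω ∂μ, M ω = N ω := by
  filter_upwards [hM.2.2 N hN.1 hN.2.1, hN.2.2 M hM.1 hM.2.1] with ω h1 h2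
  exact h2.antisymm h1

variable [NormedAddCommGroup E] [NormedSpace ℝ E] [CompleteSpace E]
  [TopologicalSpace.SeparableSpace E] [MeasurableSpace E] [BorelSpace E] [IsFiniteMeasure μ]

/-- An `H`-measurable random subset of `X` satisfies the conditional half-space constraint given
by any random functional. -/
theorem IsCondEssInfField.ae_subset_nonneg (hH : H ≤ mΩ) {X Y : Ω → Set E}
    {ζ : Ω → E →L[ℝ] ℝ} {η : Ω → E → EReal} (hη : IsCondEssInfField H μ (supportGap X ζ) η)
    (hY : IsRandomSet H Y) (hYX : ∀ᵐ ω ∂μ, Y ω ⊆ X ω) :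
    ∀ᵐ ω ∂μ, Y ω ⊆ {x : E | 0 ≤ η ω x} := by
  classical
  have : SecondCountableTopology E := UniformSpace.secondCountable_of_separable E
  refine hY.ae_subset hH (measurableSet_le measurable_const hη.1) fun γ hγ => ?_
  have hm : MeasurableSet[H] {ω | γ ω ∈ Y ω} := (measurable_id.prodMk hγ) hY
  -- `γ` may lie in `Y` only on part of `Ω`; the value `⊥` makes the bound trivial elsewhere.
  have := (hη.2 γ hγ).2.2 (fun ω => if γ ω ∈ Y ω then 0 else ⊥)
    (Measurable.ite hm measurable_const measurable_const) (by
      filter_upwards [hYX] with ω hω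
      split_ifs with h
      · exact supportGap_nonneg_iff.2 (le_supportFn (hω h) _)
      · exact bot_le)
  filter_upwards [this] with ω hω h
  simpa [h] using hω

/-- An `H`-measurable random subset of `X` satisfies the half-space constraint with the
conditional essential infimum of the support function, for any `H`-measurable functional. -/
theorem IsCondEssInf.ae_subset_le (hH : H ≤ mΩ) {X Y : Ω → Set E} {ζ : Ω → E →L[ℝ] ℝ}
    {g : Ω → EReal} (hζ : IsRandomDual H ζ)
    (hg : IsCondEssInf H μ (fun ω => supportFn (X ω) (ζ ω)) g)
    (hY : IsRandomSet H Y) (hYX : ∀ᵐ ω ∂μ, Y ω ⊆ X ω) :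
    ∀ᵐ ω ∂μ, Y ω ⊆ {x : E | ((ζ ω x : ℝ) : EReal) ≤ g ω} := by
  classical
  have : SecondCountableTopology E := UniformSpace.secondCountable_of_separable E
  have hev : Measurable[H.prod inferInstance] fun p : Ω × E => ζ p.1 p.2 :=
    @IsRandomDual.measurable_uncurry E _ _ _ _ _ Ω H ζ hζ
  have hg' : Measurable[H.prod inferInstance] fun p : Ω × E => g p.1 :=
    hg.1.comp (@measurable_fst Ω E H _)
  refine hY.ae_subset hH (measurableSet_le hev.coe_real_ereal hg') fun γ hγ => ?_
  have hγ' := (@measurable_id Ω H).prodMk hγ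
  have hm : MeasurableSet[H] {ω | γ ω ∈ Y ω} := hγ' hY
  have := hg.2.2 (fun ω => if γ ω ∈ Y ω then ((ζ ω (γ ω) : ℝ) : EReal) else ⊥)
    (Measurable.ite hm (hev.comp hγ').coe_real_ereal measurable_const) (by
      filter_upwards [hYX] with ω hω
      split_ifs with h
      · exact le_supportFn (hω h) _
      · exact bot_le)
  filter_upwards [this] with ω hω h
  simpa [h] using hω

/-- The conditional half-space constraints of a sequence that represents `X` describe a
conditional core of `X`. -/
theorem IsHalfspaceRep.isCondCore (hH : H ≤ mΩ) {X : Ω → Set E}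
    (hcl : ∀ᵐ ω ∂μ, IsClosed (X ω)) {ζ : ℕ → Ω → E →L[ℝ] ℝ} (hζ : IsHalfspaceRep μ X ζ)
    {η : ℕ → Ω → E → EReal} (hη : ∀ n, IsCondEssInfField H μ (supportGap X (ζ n)) (η n)) :
    IsCondCore H μ X fun ω => ⋂ n, {x : E | 0 ≤ η n ω x} := by
  have : SecondCountableTopology E := UniformSpace.secondCountable_of_separable E
  have hm : IsRandomSet H fun ω => ⋂ n, {x : E | 0 ≤ η n ω x} := by
    have : {p : Ω × E | p.2 ∈ ⋂ n, {x : E | 0 ≤ η n p.1 x}} =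
        ⋂ n, {p : Ω × E | 0 ≤ η n p.1 p.2} := by
      ext p
      simp
    rw [IsRandomSet, this]
    exact .iInter fun n => measurableSet_le measurable_const (hη n).1
  -- `X` itself need not be `H`-measurable, hence the comparison through closed values.
  refine ⟨hm, hm.ae_subset_of_isClosed hH hcl fun γ hγ => ?_, fun Y hY hYX => ?_⟩
  · filter_upwards [hζ.2, ae_all_iff.2 fun n => ((hη n).2 γ hγ).2.1] with ω h1 h2 h
    rw [h1]
    exact Set.mem_iInter.2 fun n =>
      supportGap_nonneg_iff.1 (le_trans (Set.mem_iInter.1 h n) (h2 n))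
  · filter_upwards [ae_all_iff.2 fun n => (hη n).ae_subset_nonneg hH hY hYX] with ω hω
    exact Set.subset_iInter hω

/-- For weakly compact convex `X`, the conditional core is described by a countable total set of
deterministic functionals. -/
theorem isCondCore_of_isCountableTotal (hH : H ≤ mΩ) {X : Ω → Set E}
    (hconv : ∀ᵐ ω ∂μ, Convex ℝ (X ω)) (hX : ∀ᵐ ω ∂μ, IsWeaklyCompact (X ω))
    {D : Set (E →L[ℝ] ℝ)} (hD : IsCountableTotal D) {g : (E →L[ℝ] ℝ) → Ω → EReal}
    (hg : ∀ u, IsCondEssInf H μ (fun ω => supportFn (X ω) u) (g u)) :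
    IsCondCore H μ X fun ω => ⋂ u ∈ D, {x : E | ((u x : ℝ) : EReal) ≤ g u ω} := by
  have : SecondCountableTopology E := UniformSpace.secondCountable_of_separable E
  refine ⟨?_, ?_, fun Y hY hYX => ?_⟩
  · have : {p : Ω × E | p.2 ∈ ⋂ u ∈ D, {x : E | ((u x : ℝ) : EReal) ≤ g u p.1}} =
        ⋂ u ∈ D, {p : Ω × E | ((u p.2 : ℝ) : EReal) ≤ g u p.1} := by
      ext p
      simp
    rw [IsRandomSet, this]
    refine .biInter hD.1 fun u _ => measurableSet_le ?_ ((hg u).1.comp (@measurable_fst Ω E H _))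
    exact (u.continuous.measurable.comp (@measurable_snd Ω E H _)).coe_real_ereal
  -- The exceptional event does not depend on `x`, so this inclusion needs no selection.
  · filter_upwards [hconv, hX, (ae_ball_iff hD.1).2 fun u _ => (hg u).2.1] with ω h1 h2 h3 x hx
    exact h2.mem_of_isCountableTotal h1 hD fun u hu =>
      le_trans (Set.mem_iInter₂.1 hx u hu) (h3 u hu)
  · filter_upwards [(ae_ball_iff hD.1).2 fun u _ =>
      (hg u).ae_subset_le hH (isRandomDual_const H u) hY hYX] with ω hω
    exact Set.subset_iInter₂ hω

end ConditionalCore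

theorem theorem4p10 {Ω E : Type*} [NormedAddCommGroup E] [NormedSpace ℝ E] [CompleteSpace E]
    [TopologicalSpace.SeparableSpace E] [MeasurableSpace E] [BorelSpace E]
    (H : MeasurableSpace Ω) {mΩ : MeasurableSpace Ω} (hH : H ≤ mΩ)
    (μ : Measure Ω) [IsProbabilityMeasure μ] [μ.IsComplete]
    (X : Ω → Set E) (hXm : IsRandomSet mΩ X)
    (hXne : ∀ᵐ ω ∂μ, (X ω).Nonempty) (hXcl : ∀ᵐ ω ∂μ, IsClosed (X ω))
    (hXconv : ∀ᵐ ω ∂μ, Convex ℝ (X ω)) :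
    -- the objects in the claim exist
    (∃ M, IsCondCore H μ X M) ∧
    (∀ ζ : Ω → E →L[ℝ] ℝ, IsRandomDual mΩ ζ →
      (∃ g, IsCondEssInf H μ (fun ω => supportFn (X ω) (ζ ω)) g) ∧
      (∃ η, IsCondEssInfField H μ (supportGap X ζ) η)) ∧
    (∃ ζ : ℕ → Ω → E →L[ℝ] ℝ, IsHalfspaceRep μ X ζ) ∧
    (∃ D : Set (E →L[ℝ] ℝ), IsCountableTotal D) ∧
    ∀ M : Ω → Set E, IsCondCore H μ X M →
      -- the bound on the support function of the core
      (∀ ζ : Ω → E →L[ℝ] ℝ, IsRandomDual H ζ →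
        ∀ g : Ω → EReal, IsCondEssInf H μ (fun ω => supportFn (X ω) (ζ ω)) g →
          ∀ᵐ ω ∂μ, supportFn (M ω) (ζ ω) ≤ g ω) ∧
      -- the dual representation, over all random elements of the dual space
      (∀ η : {ζ : Ω → E →L[ℝ] ℝ // IsRandomDual mΩ ζ} → Ω → E → EReal,
        (∀ ζ, IsCondEssInfField H μ (supportGap X ζ.1) (η ζ)) →
          IsMeasurableInter H μ (fun ζ ω => {x : E | 0 ≤ η ζ ω x}) M) ∧
      -- the dual representation, over a sequence that represents `X`
      (∀ ζ : ℕ → Ω → E →L[ℝ] ℝ, IsHalfspaceRep μ X ζ →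
        ∀ η : ℕ → Ω → E → EReal, (∀ n, IsCondEssInfField H μ (supportGap X (ζ n)) (η n)) →
          ∀ᵐ ω ∂μ, M ω = ⋂ n, {x : E | 0 ≤ η n ω x}) ∧
      -- the weakly compact case, over deterministic functionals
      ((∀ᵐ ω ∂μ, IsWeaklyCompact (X ω)) →
        ∀ g : (E →L[ℝ] ℝ) → Ω → EReal,
          (∀ u, IsCondEssInf H μ (fun ω => supportFn (X ω) u) (g u)) →
            (∀ D : Set (E →L[ℝ] ℝ), IsCountableTotal D →
              ∀ᵐ ω ∂μ, M ω = ⋂ u ∈ D, {x : E | ((u x : ℝ) : EReal) ≤ g u ω}) ∧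
            IsMeasurableInter H μ
              (fun u ω => {x : E | ((u x : ℝ) : EReal) ≤ g u ω}) M) := by

  have hfield : ∀ ζ : Ω → E →L[ℝ] ℝ, IsRandomDual mΩ ζ →
      ∃ η, IsCondEssInfField H μ (supportGap X ζ) η := fun ζ hζ =>
    exists_isCondEssInfField_supportGap hH μ hXm hXne hζ
  obtain ⟨ζ₀, hζ₀⟩ := exists_isHalfspaceRep μ hXm hXne hXcl hXconv
  obtain ⟨D₀, hD₀⟩ := exists_isCountableTotal E
  choose η₀ hη₀ using fun n => hfield (ζ₀ n) (hζ₀.1 n)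
  refine ⟨⟨_, hζ₀.isCondCore hH hXcl hη₀⟩, fun ζ hζ => ?_, ⟨ζ₀, hζ₀⟩, ⟨D₀, hD₀⟩,
    fun M hM => ⟨fun ζ hζ g hg => ?_, fun η hη => ⟨hM.1, fun ζ => ?_, fun Y hY hYη => ?_⟩,
      fun ζ hζ η hη => hM.ae_eq (hζ.isCondCore hH hXcl hη), fun hXw g hg =>
        ⟨fun D hD => hM.ae_eq (isCondCore_of_isCountableTotal hH hXconv hXw hD hg),
          hM.1, fun u => ?_, fun Y hY hYg => ?_⟩⟩⟩
  · obtain ⟨η, hη⟩ := hfield ζ hζ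
    exact ⟨⟨_, hη.isCondEssInf_supportFn⟩, ⟨η, hη⟩⟩
  · filter_upwards [hg.ae_subset_le hH hζ hM.1 hM.2.1] with ω hω
    exact supportFn_le_iff.2 fun x hx => hω hx
  · exact (hη ζ).ae_subset_nonneg hH hM.1 hM.2.1
  -- Maximality needs only the countably many constraints from `ζ₀`, whose null events can be
  -- united.
  · filter_upwards [hM.ae_eq (hζ₀.isCondCore hH hXcl fun n => hη ⟨ζ₀ n, hζ₀.1 n⟩),
      ae_all_iff.2 fun n => hYη ⟨ζ₀ n, hζ₀.1 n⟩] with ω h1 h2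
    rw [h1]
    exact Set.subset_iInter h2
  · exact (hg u).ae_subset_le hH (isRandomDual_const H u) hM.1 hM.2.1
  · filter_upwards [hM.ae_eq (isCondCore_of_isCountableTotal hH hXconv hXw hD₀ hg),
      (ae_ball_iff hD₀.1).2 fun u _ => hYg u] with ω h1 h2
    rw [h1]
    exact Set.subset_iInter₂ h2
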